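/- Let $\mathbb L=\mathbb Z[q^{\pm1},s^{\pm1}]$, and let $V$ be the free $\mathbb L$-module on $v_0,v_1,v_2,\dots$ with the operators $Kv_j=sq^{-2j}v_j$, $Ev_j=v_{j-1}$ (where $v_{-1}=0$) and $$F^{(m)}v_j=\begin{bmatrix}m+j\\ j\end{bmatrix}_q\ \prod_{k=0}^{m-1}\bigl(sq^{-k-j}-s^{-1}q^{k+j}\bigr)\,v_{j+m},$$ where the bracket is the quantum binomial coefficient formed from $[r]_q=\frac{q^r-q^{-r}}{q-q^{-1}}$. Let $\mathsf R=T\circ\mathcal C\circ\mathcal P$ on $V\otimes V$, where $\mathcal P=\sum_{m\ge0}q^{m(m-1)/2}E^m\otimes F^{(m)}$, $\mathcal C(v_i\otimes v_j)=s^{-(i+j)}q^{2ij}\,v_i\otimes v_j$, and $T$ is the flip. On $V^{\otimes n}$ let $K$ act as $K\otimes\cdots\otimes K$ and $E$ as $\sum_{i=1}^n 1^{\otimes(i-1)}\otimes E\otimes K^{\otimes(n-i)}$, and put $$W_{n,2}=\ker(E)\cap\ker(K-s^nq^{-4})\subset V^{\otimes n}.$$ For $1\le i<j\le n$ let $a_{i,j}\in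 V^{\otimes n}$ be the pure tensor with $v_1$ in positions $i$ and $j$ and $v_0$ elsewhere, let $b_k$ be the pure tensor with $v_2$ in position $k$ and $v_0$ elsewhere, and let $w_{i,j}=a_{i,j}-s^{j-i}q^{-2}b_j-s^{i-j}b_i$. Let $B_n$ be the braid group with standard generators $\sigma_1,\dots,\sigma_{n-1}$. Let $\mathrm{LKB}(2,n)$ be the Lawrence–Krammer–Bigelow representation: the free $\mathbb Z[\mathtt q^{\pm1},\mathtt t^{\pm1}]$-module on the forks $F_{i,j}$, $1\le i<j\le n$, on which $B_n$ acts by $$\begin{aligned} \sigma_i^{-1}F_{j,k}&=F_{j,k},\qquad \sigma_i^{-1}F_{i+1,j}=F_{i,j},\qquad \sigma_i^{-1}F_{j,i+1}=F_{j,i},\\ \sigma_i^{-1}F_{i,j}&=\mathtt q^{-1}F_{i+1,j}+(1-\mathtt q^{-1})F_{i,j}+\mathtt t^{-1}(\mathtt q^{-1}-\mathtt q^{-2})F_{i,i+1},\\ \sigma_i^{-1}F_{i,i+1}&=-\mathtt t^{-1}\mathtt q^{-2}F_{i,i+1},\\ \sigma_i^{-1}F_{j,i}&=\mathtt q^{-1}F_{j,i+1}+(1-\mathtt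 q^{-1})F_{j,i}-(\mathtt q^{-1}-\mathtt q^{-2})F_{i,i+1}, \end{aligned}$$ where $\{i,i+1\}\cap\{j,k\}=\emptyset$. Let $\mathrm{LKB}(2,n)^\dagger$ be this representation precomposed with the automorphism $\sigma_i\mapsto\sigma_i^{-1}$ of $B_n$, and let $\theta:\mathbb Z[\mathtt q^{\pm1},\mathtt t^{\pm1}]\to\mathbb L$ be the ring homomorphism with $\mathtt q\mapsto s^2$, $\mathtt t\mapsto-q^{-2}$. **Theorem.** For every $n>1$, these formulas define the representation $\mathrm{LKB}(2,n)$ of $B_n$, the assignment $\sigma_i\mapsto 1^{\otimes(i-1)}\otimes\mathsf R\otimes1^{\otimes(n-i-1)}$ restricts to a representation of $B_n$ on $W_{n,2}$, the $w_{i,j}$ with $1\le i<j\le n$ form an $\mathbb L$-basis of $W_{n,2}$, and there is an isomorphism of $B_n$-representations over $\mathbb L$ $$W_{n,2}\ \cong\ \mathrm{LKB}(2,n)^\dagger\otimes_\theta\mathbb L$$ under which $s^{i+j}w_{i,j}$ corresponds to $F_{i,j}\otimes1$ for all $1\le i<j\le n$. -/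

import Mathlib

open scoped TensorProduct

noncomputable section

namespace BraidLKB

/-! ### Braid groups -/

/-- The Artin relations among the generators `σ_0, …, σ_{n-2}` (numbered from zero):
`σ_i σ_{i+1} σ_i = σ_{i+1} σ_i σ_{i+1}`, and `σ_i σ_j = σ_j σ_i` for `|i - j| > 1`. -/
inductive BraidRel (n : ℕ) : FreeGroup (Fin (n - 1)) → Prop
  | braid (i j : Fin (n - 1)) (h : i.val + 1 = j.val) :
      BraidRel n ((FreeGroup.of i * FreeGroup.of j * FreeGroup.of i) *
        (FreeGroup.of j * FreeGroup.of i * FreeGroup.of j)⁻¹)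
  | comm (i j : Fin (n - 1)) (h : i.val + 1 < j.val) :
      BraidRel n ((FreeGroup.of i * FreeGroup.of j) * (FreeGroup.of j * FreeGroup.of i)⁻¹)

/-- The braid group `B_n` on `n` strands. -/
abbrev BraidGroup (n : ℕ) : Type := PresentedGroup {r | BraidRel n r}

/-- The standard generators of `B_n`. -/
def sigma {n : ℕ} (i : Fin (n - 1)) : BraidGroup n := PresentedGroup.of i

theorem sigma_braid {n : ℕ} (i j : Fin (n - 1)) (h : i.val + 1 = j.val) :
    sigma i * sigma j * sigma i = sigma j * sigma i * sigma j := by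
  have := PresentedGroup.one_of_mem (rels := {r | BraidRel n r}) (BraidRel.braid i j h)
  rw [map_mul, map_inv, mul_inv_eq_one] at this
  exact this

theorem sigma_comm {n : ℕ} (i j : Fin (n - 1)) (h : i.val + 1 < j.val) :
    sigma i * sigma j = sigma j * sigma i := by
  have := PresentedGroup.one_of_mem (rels := {r | BraidRel n r}) (BraidRel.comm i j h)
  rw [map_mul, map_inv, mul_inv_eq_one] at this
  exact this

/-- The endomorphism `σ_i ↦ σ_i⁻¹` of `B_n` (switching all crossings). -/
def mirror (n : ℕ) : BraidGroup n →* BraidGroup n :=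
  PresentedGroup.toGroup (f := fun i => (sigma i)⁻¹) (by
    rintro r (⟨i, j, h⟩ | ⟨i, j, h⟩)
    · have := congrArg (·⁻¹) (sigma_braid i j h)
      simp only [mul_inv_rev] at this
      simp only [map_mul, map_inv, FreeGroup.lift_apply_of]
      rw [mul_inv_eq_one]
      simpa only [mul_assoc] using this
    · have := congrArg (·⁻¹) (sigma_comm i j h)
      simp only [mul_inv_rev] at this
      simp only [map_mul, map_inv, FreeGroup.lift_apply_of]
      rw [mul_inv_eq_one]
      exact this.symm)

theorem mirror_sigma {n : ℕ} (i : Fin (n - 1)) : mirror n (sigma i) = (sigma i)⁻¹ :=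
  PresentedGroup.toGroup.of _

/-- The switching map is an involution, hence an automorphism. -/
theorem mirror_mirror {n : ℕ} (β : BraidGroup n) : mirror n (mirror n β) = β := by
  have : (mirror n).comp (mirror n) = MonoidHom.id _ := by
    apply PresentedGroup.ext
    intro i
    change mirror n (mirror n (sigma i)) = sigma i
    rw [mirror_sigma, map_inv, mirror_sigma, inv_inv]
  exact DFunLike.congr_fun this β

/-- The position `i` (of `n` positions) on which the generator `σ_i` acts, together with
`posR i`, the next one. -/
def posL {n : ℕ} (i : Fin (n - 1)) : Fin n := ⟨i.val, by omega⟩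

/-- The position `i + 1`. -/
def posR {n : ℕ} (i : Fin (n - 1)) : Fin n := ⟨i.val + 1, by omega⟩

theorem posL_ne_posR {n : ℕ} (i : Fin (n - 1)) : posL i ≠ posR i := by
  simp [posL, posR, Fin.ext_iff]

/-! ### The ring `𝕃 = ℤ[q^{±1}, s^{±1}]` and quantum integers -/

/-- The ring `𝕃 = ℤ[q^{±1}, s^{±1}]`, as Laurent polynomials in `s` over `ℤ[q^{±1}]`. -/
def QSRing : Type := LaurentPolynomial (LaurentPolynomial ℤ)

instance : CommRing QSRing :=
  inferInstanceAs (CommRing (LaurentPolynomial (LaurentPolynomial ℤ)))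

/-- The variable `q`, as a unit of `𝕃`. -/
def q : QSRingˣ :=
  (Units.map (LaurentPolynomial.C : LaurentPolynomial ℤ →+* _).toMonoidHom
    ⟨LaurentPolynomial.T 1, LaurentPolynomial.T (-1),
      by rw [← LaurentPolynomial.T_add]; simp, by rw [← LaurentPolynomial.T_add]; simp⟩ :
    (LaurentPolynomial (LaurentPolynomial ℤ))ˣ)

/-- The variable `s`, as a unit of `𝕃`. -/
def s : QSRingˣ :=
  (⟨LaurentPolynomial.T 1, LaurentPolynomial.T (-1),
    by rw [← LaurentPolynomial.T_add]; simp, by rw [← LaurentPolynomial.T_add]; simp⟩ :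
    (LaurentPolynomial (LaurentPolynomial ℤ))ˣ)

/-- The power `q^k`, for an integer `k`. -/
def qPow (k : ℤ) : QSRing := ((q ^ k : QSRingˣ) : QSRing)

/-- The power `s^k`, for an integer `k`. -/
def sPow (k : ℤ) : QSRing := ((s ^ k : QSRingˣ) : QSRing)

theorem qPow_add (a b : ℤ) : qPow (a + b) = qPow a * qPow b := by
  simp [qPow, zpow_add]

/-- The quantum integer `[n]_q = q^{n-1} + q^{n-3} + ⋯ + q^{1-n}`. -/
def qInt (n : ℕ) : QSRing := ∑ i ∈ Finset.range n, qPow ((n : ℤ) - 1 - 2 * i)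

/-- The quantum factorial `[n]_q!`. -/
def qFact (n : ℕ) : QSRing := ∏ i ∈ Finset.range n, qInt (i + 1)

/-- The (symmetric) quantum binomial coefficient, by its Pascal recursion. It is the quotient
`[n]_q! / ([n-k]_q! [k]_q!)`, see `qBinom_mul`. -/
def qBinom : ℕ → ℕ → QSRing
  | _, 0 => 1
  | 0, _ + 1 => 0
  | n + 1, k + 1 => qPow ((n : ℤ) - k) * qBinom n k + qPow (-((k : ℤ) + 1)) * qBinom n (k + 1)

theorem qInt_add (a b : ℕ) :
    qInt (a + b) = qPow b * qInt a + qPow (-(a : ℤ)) * qInt b := by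
  unfold qInt
  rw [Finset.sum_range_add, Finset.mul_sum, Finset.mul_sum]
  congr 1 <;> refine Finset.sum_congr rfl fun i _ => ?_ <;> rw [← qPow_add] <;> congr 1 <;>
    push_cast <;> ring

theorem qBinom_eq_zero : ∀ (n k : ℕ), n < k → qBinom n k = 0
  | 0, k + 1, _ => by rw [qBinom]
  | n + 1, k + 1, h => by
    rw [qBinom, qBinom_eq_zero n k (by omega), qBinom_eq_zero n (k + 1) (by omega)]; simp

theorem qBinom_self : ∀ n : ℕ, qBinom n n = 1
  | 0 => by rw [qBinom]
  | n + 1 => by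
    rw [qBinom, qBinom_self n, qBinom_eq_zero n (n + 1) (by omega)]; simp [qPow]

theorem qBinom_mul : ∀ (a b : ℕ), qBinom (a + b) b * (qFact a * qFact b) = qFact (a + b)
  | a, 0 => by simp [qBinom, qFact]
  | 0, b + 1 => by simp [qBinom_self, qFact]
  | a + 1, b + 1 => by
    have h1 := qBinom_mul (a + 1) b
    have h2 := qBinom_mul a (b + 1)
    have e1 : a + 1 + (b + 1) = (a + b + 1) + 1 := by ring
    rw [show a + 1 + b = a + b + 1 by ring] at h1
    rw [show a + (b + 1) = a + b + 1 by ring] at h2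
    rw [e1, qBinom]
    have hf : ∀ m, qFact (m + 1) = qFact m * qInt (m + 1) := fun m => by
      simp [qFact, Finset.prod_range_succ]
    have hI := qInt_add (b + 1) (a + 1)
    rw [show b + 1 + (a + 1) = a + b + 1 + 1 by ring] at hI
    rw [hf (a + b + 1), hI]
    have c1 : ((a + b + 1 : ℕ) : ℤ) - b = ((a + 1 : ℕ) : ℤ) := by push_cast; ring
    rw [c1, show -((b : ℤ) + 1) = -((b + 1 : ℕ) : ℤ) by push_cast; ring]
    have e2 : qFact (a + 1) * qFact (b + 1) = qFact (a + 1) * qFact b * qInt (b + 1) := by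
      rw [hf b]; ring
    have e3 : qFact (a + 1) * qFact (b + 1) = qFact a * qFact (b + 1) * qInt (a + 1) := by
      rw [hf a]; ring
    rw [add_mul, mul_assoc, mul_assoc]
    nth_rw 1 [e2]
    rw [e3, ← mul_assoc (qBinom _ _) _ (qInt (b + 1)), ← mul_assoc (qBinom _ _) _ (qInt (a + 1)),
      h1, h2]
    ring

/-! ### The generic Verma module and the R-matrix -/

/-- The generic Verma module `V`: the free `𝕃`-module on `v_0, v_1, v_2, …`. -/
def Verma : Type := ℕ →₀ QSRing

instance : AddCommGroup Verma := inferInstanceAs (AddCommGroup (ℕ →₀ QSRing))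

instance : Module QSRing Verma := inferInstanceAs (Module QSRing (ℕ →₀ QSRing))

/-- The basis `v_0, v_1, v_2, …` of `V`. -/
def vermaBasis : Module.Basis ℕ QSRing Verma :=
  (Finsupp.basisSingleOne : Module.Basis ℕ QSRing (ℕ →₀ QSRing))

/-- The basis vector `v_j`. -/
def v (j : ℕ) : Verma := vermaBasis j

/-- `K v_j = s q^{-2j} v_j`. -/
def opK : Verma →ₗ[QSRing] Verma :=
  vermaBasis.constr QSRing fun j : ℕ => (sPow 1 * qPow (-2 * (j : ℤ))) • v j

/-- `E v_j = v_{j-1}`, where `v_{-1} = 0`. -/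
def opE : Verma →ₗ[QSRing] Verma :=
  vermaBasis.constr QSRing fun j : ℕ => if j = 0 then 0 else v (j - 1)

/-- The divided power `F^{(m)}`:
`F^{(m)} v_j = [m+j choose j]_q ∏_{k<m} (s q^{-k-j} - s⁻¹ q^{k+j}) v_{j+m}`. -/
def opF (m : ℕ) : Verma →ₗ[QSRing] Verma :=
  vermaBasis.constr QSRing fun j : ℕ =>
    (qBinom (m + j) j *
      ∏ k ∈ Finset.range m,
        (sPow 1 * qPow (-(k : ℤ) - j) - sPow (-1) * qPow ((k : ℤ) + j))) • v (j + m)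

/-- The basis `v_i ⊗ v_j` of `V ⊗ V`. -/
def basisVV : Module.Basis (ℕ × ℕ) QSRing (Verma ⊗[QSRing] Verma) :=
  vermaBasis.tensorProduct vermaBasis

/-- The operator `𝒫 = ∑_m q^{m(m-1)/2} E^m ⊗ F^{(m)}` on `V ⊗ V`. On `v_i ⊗ v_j` the terms with
`m > i` vanish, because `E^m v_i = 0` for them. -/
def opP : Verma ⊗[QSRing] Verma →ₗ[QSRing] Verma ⊗[QSRing] Verma :=
  basisVV.constr QSRing fun p =>
    ∑ m ∈ Finset.range (p.1 + 1),
      qPow (m.choose 2 : ℕ) • TensorProduct.map (opE ^ m) (opF m) (v p.1 ⊗ₜ[QSRing] v p.2)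

/-- The diagonal operator `𝒞 (v_i ⊗ v_j) = s^{-(i+j)} q^{2ij} v_i ⊗ v_j`. -/
def opC : Verma ⊗[QSRing] Verma →ₗ[QSRing] Verma ⊗[QSRing] Verma :=
  basisVV.constr QSRing fun p =>
    (sPow (-((p.1 : ℤ) + p.2)) * qPow (2 * (p.1 : ℤ) * p.2)) • (v p.1 ⊗ₜ[QSRing] v p.2)

/-- The braiding `R = T ∘ 𝒞 ∘ 𝒫` of `V ⊗ V`, with `T` the flip. -/
def opR : Verma ⊗[QSRing] Verma →ₗ[QSRing] Verma ⊗[QSRing] Verma :=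
  (TensorProduct.comm QSRing Verma Verma).toLinearMap ∘ₗ opC ∘ₗ opP

/-- The tensor power `V^{⊗n}` over `𝕃`. -/
abbrev VermaTensor (n : ℕ) : Type := PiTensorProduct QSRing (fun _ : Fin n => Verma)

/-- The action of `K` on `V^{⊗n}` through the coproduct: `K ⊗ ⋯ ⊗ K`. -/
def tensorK (n : ℕ) : VermaTensor n →ₗ[QSRing] VermaTensor n :=
  PiTensorProduct.map fun _ => opK

/-- The action of `E` on `V^{⊗n}` through the coproduct `Δ E = E ⊗ K + 1 ⊗ E`, that is
`∑_i 1 ⊗ ⋯ ⊗ 1 ⊗ E ⊗ K ⊗ ⋯ ⊗ K` with `E` in position `i`. -/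
def tensorE (n : ℕ) : VermaTensor n →ₗ[QSRing] VermaTensor n :=
  ∑ i : Fin n, PiTensorProduct.map fun j : Fin n =>
    if j < i then LinearMap.id else if j = i then opE else opK

/-- The weight space `V_{n,l} = ker (K - s^n q^{-2l})` of `V^{⊗n}`. -/
def weightSpace (n l : ℕ) : Submodule QSRing (VermaTensor n) :=
  LinearMap.ker (tensorK n - (sPow n * qPow (-2 * (l : ℤ))) • LinearMap.id)

/-- The highest weight space `W_{n,l} = ker E ∩ V_{n,l}`. -/
def highestWeightSpace (n l : ℕ) : Submodule QSRing (VermaTensor n) :=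
  LinearMap.ker (tensorE n) ⊓ weightSpace n l

/-- Given vectors `x_k`, the linear map `V ⊗ V → V^{⊗n}` that sends `y ⊗ z` to `⨂ x_k` with the
factors in the (distinct) positions `i` and `j` replaced by `y` and `z`. -/
def insertPair {n : ℕ} (i j : Fin n) (hij : i ≠ j) (x : Fin n → Verma) :
    Verma ⊗[QSRing] Verma →ₗ[QSRing] VermaTensor n :=
  TensorProduct.lift (LinearMap.mk₂ QSRing
    (fun y z => PiTensorProduct.tprod QSRing (Function.update (Function.update x i y) j z))
    (fun y y' z => by
      simp only [fun w => Function.update_comm hij w z x, MultilinearMap.map_update_add])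
    (fun c y z => by
      simp only [fun w => Function.update_comm hij w z x, MultilinearMap.map_update_smul])
    (fun y z z' => by simp only [MultilinearMap.map_update_add])
    (fun c y z => by simp only [MultilinearMap.map_update_smul]))

/-- The basis `v_{α_1} ⊗ ⋯ ⊗ v_{α_n}` of `V^{⊗n}`. -/
def basisTensor (n : ℕ) : Module.Basis (Fin n → ℕ) QSRing (VermaTensor n) :=
  Basis.piTensorProduct fun _ => vermaBasis

/-- The operator `1 ⊗ ⋯ ⊗ 1 ⊗ R ⊗ 1 ⊗ ⋯ ⊗ 1` on `V^{⊗n}`, with `R` acting on the factors in the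
positions `i` and `i + 1`. -/
def braidOp (n : ℕ) (i : Fin (n - 1)) : VermaTensor n →ₗ[QSRing] VermaTensor n :=
  (basisTensor n).constr QSRing fun α =>
    insertPair (posL i) (posR i) (posL_ne_posR i) (fun k => v (α k))
      (opR (v (α (posL i)) ⊗ₜ[QSRing] v (α (posR i))))

/-- The pairs `i < j` of positions. -/
abbrev Pairs (n : ℕ) : Type := {p : Fin n × Fin n // p.1 < p.2}

/-- `a_{i,j}`: the tensor with `v_1` in the positions `i`, `j` and `v_0` elsewhere. -/
def aVec {n : ℕ} (i j : Fin n) : VermaTensor n :=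
  PiTensorProduct.tprod QSRing fun k => if k = i ∨ k = j then v 1 else v 0

/-- `b_k`: the tensor with `v_2` in the position `k` and `v_0` elsewhere. -/
def bVec {n : ℕ} (k : Fin n) : VermaTensor n :=
  PiTensorProduct.tprod QSRing fun m => if m = k then v 2 else v 0

/-- `w_{i,j} = a_{i,j} - s^{j-i} q^{-2} b_j - s^{i-j} b_i`. -/
def wVec {n : ℕ} (p : Pairs n) : VermaTensor n :=
  aVec p.1.1 p.1.2
    - (sPow ((p.1.2.val : ℤ) - p.1.1.val) * qPow (-2)) • bVec p.1.2
    - sPow ((p.1.1.val : ℤ) - p.1.2.val) • bVec p.1.1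

/-! ### The Lawrence–Krammer–Bigelow representation -/

/-- The ring `ℤ[𝚚^{±1}, 𝚝^{±1}]`, as Laurent polynomials in `𝚚` over `ℤ[𝚝^{±1}]`. -/
def QTRing : Type := LaurentPolynomial (LaurentPolynomial ℤ)

instance : CommRing QTRing :=
  inferInstanceAs (CommRing (LaurentPolynomial (LaurentPolynomial ℤ)))

/-- The power `𝚚^k`, for an integer `k`. -/
def qqPow (k : ℤ) : QTRing :=
  (LaurentPolynomial.T k : LaurentPolynomial (LaurentPolynomial ℤ))

/-- The power `𝚝^k`, for an integer `k`. -/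
def ttPow (k : ℤ) : QTRing :=
  (LaurentPolynomial.C (LaurentPolynomial.T k) : LaurentPolynomial (LaurentPolynomial ℤ))

/-- The ring homomorphism `θ : ℤ[𝚚^{±1}, 𝚝^{±1}] → 𝕃`, `𝚚 ↦ s²`, `𝚝 ↦ -q^{-2}`. -/
def theta : QTRing →+* QSRing :=
  (LaurentPolynomial.eval₂
    (LaurentPolynomial.eval₂ (Int.castRingHom QSRing) (-(q ^ (-2 : ℤ)))) (s ^ (2 : ℤ)) :
      LaurentPolynomial (LaurentPolynomial ℤ) →+* QSRing)

theorem theta_qqPow (k : ℤ) : theta (qqPow k) = sPow (2 * k) := by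
  refine (LaurentPolynomial.eval₂_T _ _ k).trans ?_
  rw [sPow, zpow_mul]

theorem theta_tt : theta (ttPow 1) = -qPow (-2) := by
  refine (LaurentPolynomial.eval₂_C _ _ _).trans ((LaurentPolynomial.eval₂_T _ _ 1).trans ?_)
  simp [qPow]

/-- `𝕃` as an algebra over `ℤ[𝚚^{±1}, 𝚝^{±1}]` through `θ`. -/
instance : Algebra QTRing QSRing := theta.toAlgebra

/-- The module of the Lawrence–Krammer–Bigelow representation: the free module over
`ℤ[𝚚^{±1}, 𝚝^{±1}]` on the forks `F_{i,j}`, `i < j`. -/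
abbrev LKBModule (n : ℕ) : Type := Pairs n →₀ QTRing

/-- The fork `F_{j,k}` (used only for `j < k`). -/
def fork {n : ℕ} (j k : Fin n) : LKBModule n :=
  if h : j < k then Finsupp.single ⟨(j, k), h⟩ 1 else 0

/-- The action of `σ_i⁻¹` on the forks `F_{j,k}` in the Lawrence–Krammer–Bigelow
representation. -/
def lkbInvOp (n : ℕ) (i : Fin (n - 1)) : LKBModule n →ₗ[QTRing] LKBModule n :=
  Finsupp.linearCombination QTRing fun p : Pairs n =>
    let j := p.1.1
    let k := p.1.2
    let a := posL i
    let b := posR i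
    if j = a ∧ k = b then
      (-(ttPow (-1) * qqPow (-2))) • fork a b
    else if j = a then
      qqPow (-1) • fork b k + (1 - qqPow (-1)) • fork a k
        + (ttPow (-1) * (qqPow (-1) - qqPow (-2))) • fork a b
    else if k = a then
      qqPow (-1) • fork j b + (1 - qqPow (-1)) • fork j a
        - (qqPow (-1) - qqPow (-2)) • fork a b
    else if j = b then fork a k
    else if k = b then fork j a
    else fork j k

/-- For a representation `ρ` of `B_n` over `ℤ[𝚚^{±1}, 𝚝^{±1}]`, the representation
`ρ^† ⊗_θ 𝕃` over `𝕃`, where `ρ^†` is `ρ` precomposed with `σ_i ↦ σ_i⁻¹`. -/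
def daggerExtend {n : ℕ} {M : Type} [AddCommGroup M] [Module QTRing M]
    (ρ : Representation QTRing (BraidGroup n) M) :
    Representation QSRing (BraidGroup n) (QSRing ⊗[QTRing] M) where
  toFun β := (ρ (mirror n β)).baseChange QSRing
  map_one' := by simp [Module.End.one_eq_id]
  map_mul' β γ := by simp [Module.End.mul_eq_comp, LinearMap.baseChange_comp]

end BraidLKB

end

open BraidLKB
open scoped TensorProduct

/-!
The proof compares two group actions through explicit bases, and the only relations of `B_n` that
have to be checked are those of the Lawrence–Krammer–Bigelow operators.

On the fork side, `lkbInvOp_braid` and `lkbInvOp_comm` verify the Artin relations on every fork,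
and each operator is invertible since it is a surjective endomorphism of a finitely generated module
over a commutative ring (`isUnit_lkbInvOp`). This gives `lkbRep`.

On the tensor side, let `α = δ_j + δ_k` range over the exponents of degree two. `K` acts diagonally,
and the weights `s^n q^{-2d}` are distinct for distinct degrees `d`, so `W_{n,2}` lies in the span of
the `a_{j,k}` and the `b_k`. Since `E b_k` is a unit multiple of the basis vector with `v_1` in
position `k` and `v_0` elsewhere, an element of `W_{n,2}` is determined by its coefficients at the
`a_{j,k}` (`eq_zero_of_repr_eq_zero`), and `w_{j,k} ∈ W_{n,2}` is the element with coefficient `1` at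
`a_{j,k}` and `0` at all the others. Hence the `w_{j,k}` form a basis (`wBasis`).

The R-matrix only involves `v_i ⊗ v_j` with `i + j ≤ 2` here. After scaling by `s^{j+k}` its matrix
on the `w_{j,k}` is the image under `θ` of the matrix of `σ_i⁻¹` on the forks
(`braidOp_forkToTensor`). So the operators `braidOp n i` preserve `W_{n,2}`, and transporting the
fork representation along the isomorphism of bases gives the representation on `W_{n,2}`; that the
restricted R-matrices satisfy the Artin relations is a consequence of the relations for forks.
-/

noncomputable section

namespace BraidLKB

/-! ### The Lawrence–Krammer–Bigelow operators satisfy the Artin relations -/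

theorem qqPow_add (a b : ℤ) : qqPow (a + b) = qqPow a * qqPow b :=
  LaurentPolynomial.T_add a b

theorem ttPow_add (a b : ℤ) : ttPow (a + b) = ttPow a * ttPow b := by
  unfold ttPow
  rw [LaurentPolynomial.T_add, map_mul]
  rfl

theorem qqPow_zero : qqPow 0 = 1 := LaurentPolynomial.T_zero

theorem ttPow_zero : ttPow 0 = 1 := by
  unfold ttPow
  rw [LaurentPolynomial.T_zero, map_one]
  rfl

theorem qqPow_neg_two : qqPow (-2) = qqPow (-1) ^ 2 := by
  rw [sq, ← qqPow_add]
  norm_num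

/-- The fork `F_{j,k}` with its positions given as natural numbers, so that arithmetic side
conditions on the positions are decided by `omega`. It is zero unless `j < k < n`. -/
def natFork (n j k : ℕ) : LKBModule n :=
  if h : j < n ∧ k < n then fork ⟨j, h.1⟩ ⟨k, h.2⟩ else 0

theorem natFork_val {n : ℕ} (j k : Fin n) : natFork n j k = fork j k := by
  simp [natFork]

theorem single_eq_natFork {n : ℕ} (p : Pairs n) :
    (Finsupp.single p 1 : LKBModule n) = natFork n p.1.1 p.1.2 := by
  rw [natFork_val, fork, dif_pos p.2]

theorem lkbInvOp_natFork {n : ℕ} (i : Fin (n - 1)) {j k : ℕ} (hjk : j < k) (hk : k < n) :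
    lkbInvOp n i (natFork n j k) =
      if j = i ∧ k = i + 1 then (-(ttPow (-1) * qqPow (-1) ^ 2)) • natFork n i (i + 1)
      else if j = i then
        qqPow (-1) • natFork n (i + 1) k + (1 - qqPow (-1)) • natFork n i k
          + (ttPow (-1) * (qqPow (-1) - qqPow (-1) ^ 2)) • natFork n i (i + 1)
      else if k = i then
        qqPow (-1) • natFork n j (i + 1) + (1 - qqPow (-1)) • natFork n j i
          - (qqPow (-1) - qqPow (-1) ^ 2) • natFork n i (i + 1)
      else if j = i + 1 then natFork n i k
      else if k = i + 1 then natFork n j i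
      else natFork n j k := by
  have hi : (i : ℕ) + 1 < n := by omega
  have hi' : (i : ℕ) < n := by omega
  have hj : j < n := by omega
  simp only [natFork, hi, hi', hj, hk, and_self, dite_true]
  conv_lhs =>
    rw [fork, dif_pos (by simpa using hjk), lkbInvOp, Finsupp.linearCombination_single, one_smul]
  simp only [posL, posR, Fin.ext_iff, qqPow_neg_two]

section
variable {n : ℕ} (i : Fin (n - 1)) {j k : ℕ}

theorem lkbInvOp_left_right (hj : j = i) (hk : k = i + 1) :
    lkbInvOp n i (natFork n j k) =
      (-(ttPow (-1) * qqPow (-1) ^ 2)) • natFork n i (i + 1) := by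
  rw [lkbInvOp_natFork i (by omega) (by omega), if_pos ⟨hj, hk⟩]

theorem lkbInvOp_left_out (hj : j = i) (hk : (i : ℕ) + 1 < k) (hkn : k < n) :
    lkbInvOp n i (natFork n j k) =
      qqPow (-1) • natFork n (i + 1) k + (1 - qqPow (-1)) • natFork n i k
        + (ttPow (-1) * (qqPow (-1) - qqPow (-1) ^ 2)) • natFork n i (i + 1) := by
  rw [lkbInvOp_natFork i (by omega) hkn, if_neg (by omega), if_pos hj]

theorem lkbInvOp_out_left (hj : j < i) (hk : k = i) :
    lkbInvOp n i (natFork n j k) =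
      qqPow (-1) • natFork n j (i + 1) + (1 - qqPow (-1)) • natFork n j i
        - (qqPow (-1) - qqPow (-1) ^ 2) • natFork n i (i + 1) := by
  rw [lkbInvOp_natFork i (by omega) (by omega), if_neg (by omega), if_neg (by omega), if_pos hk]

theorem lkbInvOp_right_out (hj : j = i + 1) (hk : (i : ℕ) + 1 < k) (hkn : k < n) :
    lkbInvOp n i (natFork n j k) = natFork n i k := by
  rw [lkbInvOp_natFork i (by omega) hkn, if_neg (by omega), if_neg (by omega), if_neg (by omega),
    if_pos hj]

theorem lkbInvOp_out_right (hj : j < i) (hk : k = i + 1) :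
    lkbInvOp n i (natFork n j k) = natFork n j i := by
  rw [lkbInvOp_natFork i (by omega) (by omega), if_neg (by omega), if_neg (by omega),
    if_neg (by omega), if_neg (by omega), if_pos hk]

theorem lkbInvOp_out_out (hjk : j < k) (hkn : k < n) (hj : j ≠ i) (hj' : j ≠ i + 1)
    (hk : k ≠ i) (hk' : k ≠ i + 1) :
    lkbInvOp n i (natFork n j k) = natFork n j k := by
  rw [lkbInvOp_natFork i hjk hkn, if_neg (by omega), if_neg hj, if_neg hk, if_neg hj', if_neg hk']

end

/-- Linear endomorphisms of the fork module agree if they agree on all forks. -/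
theorem lkb_ext {n : ℕ} {f g : LKBModule n →ₗ[QTRing] LKBModule n}
    (h : ∀ j k : ℕ, j < k → k < n → f (natFork n j k) = g (natFork n j k)) : f = g := by
  refine Finsupp.lhom_ext' fun p => LinearMap.ext_ring ?_
  have := h p.1.1 p.1.2 p.2 p.1.2.2
  simpa [single_eq_natFork] using this

theorem lkbInvOp_braid {n : ℕ} (i j : Fin (n - 1)) (h : i.val + 1 = j.val) :
    lkbInvOp n i * lkbInvOp n j * lkbInvOp n i = lkbInvOp n j * lkbInvOp n i * lkbInvOp n j := by
  have hj := j.2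
  have h' : (j : ℕ) = i + 1 := h.symm
  refine lkb_ext fun x y hxy hy => ?_
  simp only [Module.End.mul_apply]
  -- a case for each way the two positions meet the three strands involved
  have hx : x = i ∨ x = i + 1 ∨ x = i + 1 + 1 ∨ (x ≠ i ∧ x ≠ i + 1 ∧ x ≠ i + 1 + 1) := by omega
  have hy : y = i ∨ y = i + 1 ∨ y = i + 1 + 1 ∨ (y ≠ i ∧ y ≠ i + 1 ∧ y ≠ i + 1 + 1) := by omega
  rcases hx with hx | hx | hx | hx <;> rcases hy with hy | hy | hy | hy <;>
    first
    | (exfalso; omega)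
    | (try subst hx
       try subst hy
       simp (disch := omega) only [lkbInvOp_left_right, lkbInvOp_left_out, lkbInvOp_out_left,
         lkbInvOp_right_out, lkbInvOp_out_right, lkbInvOp_out_out, map_add, map_sub, map_smul, h']
       try module)

theorem lkbInvOp_comm {n : ℕ} (i l : Fin (n - 1)) (h : i.val + 1 < l.val) :
    lkbInvOp n i * lkbInvOp n l = lkbInvOp n l * lkbInvOp n i := by
  have hl := l.2
  refine lkb_ext fun x y hxy hy => ?_
  simp only [Module.End.mul_apply]
  have hx : x = i ∨ x = i + 1 ∨ x = l ∨ x = l + 1 ∨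
    (x ≠ i ∧ x ≠ i + 1 ∧ x ≠ l ∧ x ≠ l + 1) := by omega
  have hy : y = i ∨ y = i + 1 ∨ y = l ∨ y = l + 1 ∨
    (y ≠ i ∧ y ≠ i + 1 ∧ y ≠ l ∧ y ≠ l + 1) := by omega
  rcases hx with hx | hx | hx | hx | hx <;> rcases hy with hy | hy | hy | hy | hy <;>
    first
    | (exfalso; omega)
    | (try subst hx
       try subst hy
       simp (disch := omega) only [lkbInvOp_left_right, lkbInvOp_left_out, lkbInvOp_out_left,
         lkbInvOp_right_out, lkbInvOp_out_right, lkbInvOp_out_out, map_add, map_sub, map_smul]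
       try module)

/-- Every fork is in the range of the operator of `σ_i⁻¹`, because `𝚚` and `𝚝` are invertible. -/
theorem lkbInvOp_surjective {n : ℕ} (i : Fin (n - 1)) : Function.Surjective (lkbInvOp n i) := by
  have hi : (i : ℕ) + 1 < n := by omega
  have hq : qqPow 1 * qqPow (-1) = 1 := by rw [← qqPow_add]; exact qqPow_zero
  have ht : ttPow 1 * ttPow (-1) = 1 := by rw [← ttPow_add]; exact ttPow_zero
  rw [← LinearMap.range_eq_top, eq_top_iff]
  set S := LinearMap.range (lkbInvOp n i) with hS
  have mem (x : LKBModule n) : lkbInvOp n i x ∈ S := ⟨x, rfl⟩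
  have h0 : natFork n i (i + 1) ∈ S := by
    have := S.smul_mem (-(ttPow 1 * qqPow 1 ^ 2)) (mem (natFork n i (i + 1)))
    rw [lkbInvOp_left_right i rfl rfl, smul_smul] at this
    convert this using 1
    have : -(ttPow 1 * qqPow 1 ^ 2) * -(ttPow (-1) * qqPow (-1) ^ 2) = 1 := by
      linear_combination (qqPow 1 ^ 2 * qqPow (-1) ^ 2) * ht + (qqPow 1 * qqPow (-1) + 1) * hq
    rw [this, one_smul]
  have key (j k : ℕ) (hjk : j < k) (hk : k < n) : natFork n j k ∈ S := by
    have cancel (x : LKBModule n) (hx : qqPow (-1) • x ∈ S) : x ∈ S := by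
      have := S.smul_mem (qqPow 1) hx
      rwa [smul_smul, hq, one_smul] at this
    have hL (k : ℕ) (h1 : (i : ℕ) + 1 < k) (h2 : k < n) : natFork n i k ∈ S := by
      rw [← lkbInvOp_right_out i rfl h1 h2]
      exact mem _
    have hR (j : ℕ) (h1 : j < i) : natFork n j i ∈ S := by
      rw [← lkbInvOp_out_right i h1 rfl]
      exact mem _
    by_cases hji : j = i
    · subst hji
      by_cases hki : k = i + 1
      · subst hki
        exact h0
      · exact hL k (by omega) hk
    by_cases hki : k = i
    · subst hki
      exact hR j hjk
    by_cases hji' : j = i + 1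
    · subst hji'
      apply cancel
      have := mem (natFork n i k)
      rw [lkbInvOp_left_out i rfl hjk hk] at this
      rwa [S.add_mem_iff_left (S.smul_mem _ h0),
        S.add_mem_iff_left (S.smul_mem _ (hL k hjk hk))] at this
    by_cases hki' : k = i + 1
    · subst hki'
      apply cancel
      have := mem (natFork n j i)
      rw [lkbInvOp_out_left i (by omega) rfl] at this
      rwa [S.sub_mem_iff_left (S.smul_mem _ h0),
        S.add_mem_iff_left (S.smul_mem _ (hR j (by omega)))] at this
    · rw [← lkbInvOp_out_out i hjk hk hji hji' hki hki']
      exact mem _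
  rintro x -
  induction x using Finsupp.induction_linear with
  | zero => exact S.zero_mem
  | add f g hf hg => exact S.add_mem hf hg
  | single p c =>
    have := S.smul_mem c (key p.1.1 p.1.2 p.2 p.1.2.2)
    rwa [← single_eq_natFork, Finsupp.smul_single_one] at this

theorem isUnit_lkbInvOp {n : ℕ} (i : Fin (n - 1)) : IsUnit (lkbInvOp n i) :=
  (Module.End.isUnit_iff _).2
    ⟨OrzechProperty.injective_of_surjective_endomorphism _ (lkbInvOp_surjective i),
      lkbInvOp_surjective i⟩

/-- The Lawrence–Krammer–Bigelow representation `LKB(2, n)`. -/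
def lkbRep (n : ℕ) : Representation QTRing (BraidGroup n) (LKBModule n) :=
  (Units.coeHom _).comp <| PresentedGroup.toGroup (f := fun i => (isUnit_lkbInvOp i).unit⁻¹) (by
    rintro r (⟨i, j, h⟩ | ⟨i, j, h⟩)
    · simp only [map_mul, map_inv, FreeGroup.lift_apply_of]
      rw [mul_inv_eq_one, ← inv_inj]
      simp only [mul_inv_rev, inv_inv]
      ext1
      simpa [mul_assoc] using lkbInvOp_braid i j h
    · simp only [map_mul, map_inv, FreeGroup.lift_apply_of]
      rw [mul_inv_eq_one, ← inv_inj]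
      simp only [mul_inv_rev, inv_inv]
      ext1
      simpa using (lkbInvOp_comm i j h).symm)

theorem lkbRep_sigma_inv {n : ℕ} (i : Fin (n - 1)) : lkbRep n (sigma i)⁻¹ = lkbInvOp n i := by
  simp only [lkbRep, MonoidHom.comp_apply, map_inv]
  erw [PresentedGroup.toGroup.of]
  simp

/-! ### The R-matrix in low degrees -/

theorem sPow_add (a b : ℤ) : sPow (a + b) = sPow a * sPow b := by
  simp [sPow, zpow_add]

theorem qPow_zero : qPow 0 = 1 := by simp [qPow]

theorem sPow_zero : sPow 0 = 1 := by simp [sPow]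

theorem qPow_two : qPow 2 = qPow 1 ^ 2 := by rw [sq, ← qPow_add]; norm_num

theorem qPow_neg_two : qPow (-2) = qPow (-1) ^ 2 := by rw [sq, ← qPow_add]; norm_num

theorem sPow_neg_two : sPow (-2) = sPow (-1) ^ 2 := by rw [sq, ← sPow_add]; norm_num

theorem qPow_mul_neg (a : ℤ) : qPow a * qPow (-a) = 1 := by
  rw [← qPow_add, add_neg_cancel, qPow_zero]

theorem sPow_mul_neg (a : ℤ) : sPow a * sPow (-a) = 1 := by
  rw [← sPow_add, add_neg_cancel, sPow_zero]

theorem opK_v (j : ℕ) : opK (v j) = (sPow 1 * qPow (-2 * (j : ℤ))) • v j :=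
  vermaBasis.constr_basis _ _ _

theorem opE_zero : opE (v 0) = 0 :=
  (vermaBasis.constr_basis _ _ _).trans (if_pos rfl)

theorem opE_succ (j : ℕ) : opE (v (j + 1)) = v j :=
  (vermaBasis.constr_basis _ _ _).trans (if_neg j.succ_ne_zero)

theorem opF_v (m j : ℕ) : opF m (v j) = (qBinom (m + j) j *
    ∏ k ∈ Finset.range m,
      (sPow 1 * qPow (-(k : ℤ) - j) - sPow (-1) * qPow ((k : ℤ) + j))) • v (j + m) :=
  vermaBasis.constr_basis _ _ _

theorem opP_v (i j : ℕ) : opP (v i ⊗ₜ v j) = ∑ m ∈ Finset.range (i + 1),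
    qPow (m.choose 2 : ℕ) • ((opE ^ m) (v i) ⊗ₜ[QSRing] opF m (v j)) := by
  have := basisVV.constr_basis QSRing (fun p : ℕ × ℕ => ∑ m ∈ Finset.range (p.1 + 1),
      qPow (m.choose 2 : ℕ) • TensorProduct.map (opE ^ m) (opF m) (v p.1 ⊗ₜ[QSRing] v p.2)) (i, j)
  rw [basisVV, Module.Basis.tensorProduct_apply] at this
  exact this

theorem opC_v (i j : ℕ) : opC (v i ⊗ₜ v j) =
    (sPow (-((i : ℤ) + j)) * qPow (2 * (i : ℤ) * j)) • (v i ⊗ₜ[QSRing] v j) := by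
  have := basisVV.constr_basis QSRing (fun p : ℕ × ℕ =>
    (sPow (-((p.1 : ℤ) + p.2)) * qPow (2 * (p.1 : ℤ) * p.2)) • (v p.1 ⊗ₜ[QSRing] v p.2)) (i, j)
  rw [basisVV, Module.Basis.tensorProduct_apply] at this
  exact this

theorem opR_apply (x : Verma ⊗[QSRing] Verma) :
    opR x = TensorProduct.comm QSRing Verma Verma (opC (opP x)) := rfl

theorem opR_zero_left (j : ℕ) : opR (v 0 ⊗ₜ v j) = sPow (-(j : ℤ)) • (v j ⊗ₜ v 0) := by
  simp [opR_apply, opP_v, opF_v, opC_v, qPow_zero, qBinom_self]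

theorem opR_one_zero : opR (v 1 ⊗ₜ v 0) =
    sPow (-1) • (v 0 ⊗ₜ v 1) + (1 - sPow (-2)) • (v 1 ⊗ₜ v 0) := by
  have h1 := opE_succ 0
  simp only [zero_add] at h1
  simp [opR_apply, opP_v, opF_v, opC_v, qPow_zero, Finset.sum_range_succ, qBinom, h1, smul_smul,
    sPow_neg_two]
  match_scalars
  linear_combination sPow_mul_neg 1

theorem opR_one_one : opR (v 1 ⊗ₜ v 1) = (sPow (-2) * qPow 2) • (v 1 ⊗ₜ v 1) +
    (sPow (-1) * (1 + qPow (-2)) * (1 - sPow (-2) * qPow 2)) • (v 2 ⊗ₜ v 0) := by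
  have h1 := opE_succ 0
  simp only [zero_add] at h1
  simp [opR_apply, opP_v, opF_v, opC_v, qPow_zero, Finset.sum_range_succ, qBinom, h1, smul_smul,
    sPow_neg_two, qPow_two, qPow_neg_two]
  have hq := qPow_mul_neg 1
  have hs := sPow_mul_neg 1
  match_scalars
  grind

theorem opR_two_zero : opR (v 2 ⊗ₜ v 0) = sPow (-2) • (v 0 ⊗ₜ v 2) +
    (sPow (-1) * qPow 2 * (1 - sPow (-2))) • (v 1 ⊗ₜ v 1) +
    ((1 - sPow (-2)) * (1 - sPow (-2) * qPow 2)) • (v 2 ⊗ₜ v 0) := by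
  have h1 := opE_succ 0
  have h2 := opE_succ 1
  simp only [zero_add, one_add_one_eq_two] at h1 h2
  simp [opR_apply, opP_v, opF_v, opC_v, qPow_zero, Finset.sum_range_succ, qBinom, h1, h2,
    smul_smul, sPow_neg_two, qPow_two, pow_two (M := Module.End QSRing Verma),
    Finset.prod_range_succ]
  have hq := qPow_mul_neg 1
  have hs := sPow_mul_neg 1
  match_scalars
  all_goals grind

/-! ### The braiding on the vectors of degree two -/

/-- The basis vector of `V^{⊗n}` of degree two with one unit of degree in each of the positions `j`
and `k`: it is `a_{j,k}` if `j ≠ k`, and `b_j` if `j = k`. The positions are natural numbers, and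
the vector is zero unless both are less than `n`. -/
def degTwo (n j k : ℕ) : VermaTensor n :=
  if h : j < n ∧ k < n then
    basisTensor n (Pi.single (⟨j, h.1⟩ : Fin n) 1 + Pi.single (⟨k, h.2⟩ : Fin n) 1)
  else 0

theorem degTwo_val {n : ℕ} (j k : Fin n) :
    degTwo n j k = basisTensor n (Pi.single j 1 + Pi.single k 1) := by
  simp [degTwo]

theorem degTwo_comm (n j k : ℕ) : degTwo n j k = degTwo n k j := by
  by_cases h : j < n ∧ k < n
  · rw [degTwo, degTwo, dif_pos h, dif_pos h.symm, add_comm]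
  · rw [degTwo, degTwo, dif_neg h, dif_neg fun h' => h h'.symm]

theorem aVec_eq {n : ℕ} {j k : Fin n} (h : j ≠ k) : aVec j k = degTwo n j k := by
  rw [degTwo_val, basisTensor, Basis.piTensorProduct_apply, aVec]
  congr 1
  funext m
  by_cases h1 : m = j
  · subst h1
    simp [h, v]
  · by_cases h2 : m = k
    · subst h2
      simp [h1, v]
    · simp [h1, h2, v]

theorem bVec_eq {n : ℕ} (k : Fin n) : bVec k = degTwo n k k := by
  rw [degTwo_val, basisTensor, Basis.piTensorProduct_apply, bVec]
  congr 1
  funext m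
  by_cases h1 : m = k
  · subst h1
    simp [v]
  · simp [h1, v]

theorem insertPair_v {n : ℕ} {i j : Fin n} (hij : i ≠ j) (α : Fin n → ℕ) (x y : ℕ) :
    insertPair i j hij (fun k => v (α k)) (v x ⊗ₜ v y) =
      basisTensor n (Function.update (Function.update α i x) j y) := by
  rw [basisTensor, Basis.piTensorProduct_apply, insertPair, TensorProduct.lift.tmul,
    LinearMap.mk₂_apply]
  congr 1
  funext m
  by_cases h1 : m = j
  · subst h1
    simp [v]
  · by_cases h2 : m = i
    · subst h2
      simp [h1, v]
    · simp [h1, h2, v]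

theorem braidOp_basis {n : ℕ} (i : Fin (n - 1)) (α : Fin n → ℕ) :
    braidOp n i (basisTensor n α) =
      insertPair (posL i) (posR i) (posL_ne_posR i) (fun k => v (α k))
        (opR (v (α (posL i)) ⊗ₜ[QSRing] v (α (posR i)))) :=
  (basisTensor n).constr_basis _ _ _

section
variable {n : ℕ} (i : Fin (n - 1)) {j k : ℕ}

/-- The product of the vectors `v_{α_m}`, where `α = δ_j + δ_k`, with the factors in the positions
`i` and `i + 1` replaced by `v_x` and `v_y`. -/
theorem insertPair_degTwo {j' k' x y : ℕ} (hj : j' < n) (hk : k' < n)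
    (h : ∀ m : ℕ, (if m = i + 1 then y else if m = i then x else
      (if m = j then 1 else 0) + (if m = k then 1 else 0)) =
        (if m = j' then 1 else 0) + (if m = k' then 1 else 0)) :
    insertPair (posL i) (posR i) (posL_ne_posR i)
      (fun m => v ((if (m : ℕ) = j then 1 else 0) + (if (m : ℕ) = k then 1 else 0)))
      (v x ⊗ₜ v y) = degTwo n j' k' := by
  rw [insertPair_v, degTwo, dif_pos ⟨hj, hk⟩]
  congr 1
  funext m
  have := h m
  simpa [Function.update_apply, Pi.single_apply, Fin.ext_iff, posL, posR] using this

theorem braidOp_degTwo (hj : j < n) (hk : k < n) {x y : ℕ}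
    (hx : (if j = i then 1 else 0) + (if k = i then 1 else 0) = x)
    (hy : (if j = i + 1 then 1 else 0) + (if k = i + 1 then 1 else 0) = y) :
    braidOp n i (degTwo n j k) = insertPair (posL i) (posR i) (posL_ne_posR i)
      (fun m => v ((if (m : ℕ) = j then 1 else 0) + (if (m : ℕ) = k then 1 else 0)))
      (opR (v x ⊗ₜ v y)) := by
  rw [degTwo, dif_pos ⟨hj, hk⟩, braidOp_basis]
  subst hx hy
  simp only [Pi.add_apply, Pi.single_apply, Fin.ext_iff, posL, posR, eq_comm]

theorem braidOp_left_left (hj : j = i) (hk : k = i) : braidOp n i (degTwo n j k) =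
    sPow (-2) • degTwo n (i + 1) (i + 1) +
    (sPow (-1) * qPow 2 * (1 - sPow (-2))) • degTwo n i (i + 1) +
    ((1 - sPow (-2)) * (1 - sPow (-2) * qPow 2)) • degTwo n i i := by
  rw [braidOp_degTwo i (x := 2) (y := 0) (by omega) (by omega) (by split_ifs; omega)
    (by split_ifs <;> omega), opR_two_zero, map_add, map_add, map_smul, map_smul, map_smul,
    insertPair_degTwo i (j' := i + 1) (k' := i + 1), insertPair_degTwo i (j' := i) (k' := i + 1),
    insertPair_degTwo i (j' := i) (k' := i)]
  all_goals first | omega | (intro m; split_ifs <;> omega)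

theorem braidOp_right_right (hj : j = i + 1) (hk : k = i + 1) : braidOp n i (degTwo n j k) =
    sPow (-2) • degTwo n i i := by
  rw [braidOp_degTwo i (x := 0) (y := 2) (by omega) (by omega) (by split_ifs <;> omega)
    (by split_ifs; omega), opR_zero_left, map_smul, insertPair_degTwo i (j' := i) (k' := i)]
  · norm_cast
  all_goals first | omega | (intro m; split_ifs <;> omega)

theorem braidOp_left_right (hj : j = i) (hk : k = i + 1) : braidOp n i (degTwo n j k) =
    (sPow (-2) * qPow 2) • degTwo n i (i + 1) +
    (sPow (-1) * (1 + qPow (-2)) * (1 - sPow (-2) * qPow 2)) • degTwo n i i := by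
  rw [braidOp_degTwo i (x := 1) (y := 1) (by omega) (by omega) (by split_ifs <;> omega)
    (by split_ifs <;> omega), opR_one_one, map_add, map_smul, map_smul,
    insertPair_degTwo i (j' := i) (k' := i + 1), insertPair_degTwo i (j' := i) (k' := i)]
  all_goals first | omega | (intro m; split_ifs <;> omega)

theorem braidOp_left_out (hj : j = i) (hk : k ≠ i) (hk' : k ≠ i + 1) (hkn : k < n) :
    braidOp n i (degTwo n j k) =
    sPow (-1) • degTwo n (i + 1) k + (1 - sPow (-2)) • degTwo n i k := by
  rw [braidOp_degTwo i (x := 1) (y := 0) (by omega) (by omega) (by split_ifs; omega)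
    (by split_ifs <;> omega), opR_one_zero, map_add, map_smul, map_smul,
    insertPair_degTwo i (j' := i + 1) (k' := k), insertPair_degTwo i (j' := i) (k' := k)]
  all_goals first | omega | (intro m; split_ifs <;> omega)

theorem braidOp_right_out (hj : j = i + 1) (hk : k ≠ i) (hk' : k ≠ i + 1) (hkn : k < n) :
    braidOp n i (degTwo n j k) = sPow (-1) • degTwo n i k := by
  rw [braidOp_degTwo i (x := 0) (y := 1) (by omega) (by omega) (by split_ifs <;> omega)
    (by split_ifs; omega), opR_zero_left, map_smul, insertPair_degTwo i (j' := i) (k' := k)]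
  · norm_cast
  all_goals first | omega | (intro m; split_ifs <;> omega)

theorem braidOp_out_out (hj : j ≠ i) (hj' : j ≠ i + 1) (hk : k ≠ i) (hk' : k ≠ i + 1)
    (hjn : j < n) (hkn : k < n) : braidOp n i (degTwo n j k) = degTwo n j k := by
  rw [braidOp_degTwo i (x := 0) (y := 0) (by omega) (by omega) (by split_ifs <;> omega)
    (by split_ifs <;> omega), opR_zero_left, map_smul, insertPair_degTwo i (j' := j) (k' := k)]
  · simp [sPow_zero]
  all_goals first | omega | (intro m; split_ifs <;> omega)

end

/-- The vector `degTwo n j k` scaled by `s^{(j+1)+(k+1)}`; the shifts come from the numbering of the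
positions from zero. In this normalization only even powers of `s` enter the braiding. -/
def scaledTwo (n j k : ℕ) : VermaTensor n := sPow (j + k + 2) • degTwo n j k

/-- The scaled highest weight vector `s^{(j+1)+(k+1)} w_{j,k}`. -/
def scaledW (n j k : ℕ) : VermaTensor n :=
  scaledTwo n j k - qPow (-2) • scaledTwo n k k - scaledTwo n j j

theorem scaledW_eq {n : ℕ} (p : Pairs n) : scaledW n p.1.1 p.1.2 =
    sPow ((p.1.1.val + 1 : ℤ) + (p.1.2.val + 1)) • wVec p := by
  simp only [wVec, aVec_eq p.2.ne, bVec_eq, scaledW, scaledTwo, smul_sub, smul_smul, ← mul_assoc,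
    ← sPow_add, mul_comm (qPow (-2))]
  have e1 : (p.1.1.val : ℤ) + p.1.2.val + 2 = p.1.1.val + 1 + (p.1.2.val + 1) := by ring
  have e2 : (p.1.2.val : ℤ) + p.1.2.val + 2 =
    p.1.1.val + 1 + (p.1.2.val + 1) + (p.1.2.val - p.1.1.val) := by ring
  have e3 : (p.1.1.val : ℤ) + p.1.1.val + 2 =
    p.1.1.val + 1 + (p.1.2.val + 1) + (p.1.1.val - p.1.2.val) := by ring
  rw [e1, e2, e3]

section
variable {n : ℕ} (i : Fin (n - 1)) {j k : ℕ}

theorem braidOp_scaledTwo_left_left (hj : j = i) (hk : k = i) : braidOp n i (scaledTwo n j k) =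
    sPow (-2) ^ 2 • scaledTwo n (i + 1) (i + 1) +
    (qPow 2 * (sPow (-2) - sPow (-2) ^ 2)) • scaledTwo n i (i + 1) +
    ((1 - sPow (-2)) * (1 - sPow (-2) * qPow 2)) • scaledTwo n i i := by
  have e1 : sPow (i + i + 2) = sPow (-2) * sPow ((i + 1 : ℕ) + (i + 1 : ℕ) + 2) := by
    rw [← sPow_add]; congr 1; push_cast; ring
  have e2 : sPow (i + i + 2) * sPow (-1) = sPow (-2) * sPow (i + (i + 1 : ℕ) + 2) := by
    rw [← sPow_add, ← sPow_add]; congr 1; push_cast; ring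
  push_cast at e1 e2
  rw [scaledTwo, map_smul, braidOp_left_left i hj hk]
  simp only [scaledTwo, hj, hk]
  match_scalars
  · linear_combination sPow (-2) * e1
  · linear_combination qPow 2 * (1 - sPow (-2)) * e2
  · ring

theorem braidOp_scaledTwo_right_right (hj : j = i + 1) (hk : k = i + 1) :
    braidOp n i (scaledTwo n j k) = scaledTwo n i i := by
  rw [scaledTwo, map_smul, braidOp_right_right i hj hk, smul_smul, ← sPow_add, scaledTwo, hj, hk]
  congr 2; push_cast; ring

theorem braidOp_scaledTwo_left_right (hj : j = i) (hk : k = i + 1) :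
    braidOp n i (scaledTwo n j k) = (sPow (-2) * qPow 2) • scaledTwo n i (i + 1) +
    ((1 + qPow (-2)) * (1 - sPow (-2) * qPow 2)) • scaledTwo n i i := by
  have e : sPow (i + (i + 1 : ℕ) + 2) * sPow (-1) = sPow (i + i + 2) := by
    rw [← sPow_add]; congr 1; push_cast; ring
  push_cast at e
  rw [scaledTwo, map_smul, braidOp_left_right i hj hk]
  simp only [scaledTwo, hj, hk]
  match_scalars
  · ring
  · linear_combination (1 + qPow (-2)) * (1 - sPow (-2) * qPow 2) * e

theorem braidOp_scaledTwo_left_out (hj : j = i) (hk : k ≠ i) (hk' : k ≠ i + 1) (hkn : k < n) :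
    braidOp n i (scaledTwo n j k) =
      sPow (-2) • scaledTwo n (i + 1) k + (1 - sPow (-2)) • scaledTwo n i k := by
  have e : sPow (i + k + 2) * sPow (-1) = sPow (-2) * sPow ((i + 1 : ℕ) + k + 2) := by
    rw [← sPow_add, ← sPow_add]; congr 1; push_cast; ring
  push_cast at e
  rw [scaledTwo, map_smul, braidOp_left_out i hj hk hk' hkn]
  simp only [scaledTwo, hj]
  match_scalars
  · linear_combination e
  · ring

theorem braidOp_scaledTwo_right_out (hj : j = i + 1) (hk : k ≠ i) (hk' : k ≠ i + 1) (hkn : k < n) :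
    braidOp n i (scaledTwo n j k) = scaledTwo n i k := by
  rw [scaledTwo, map_smul, braidOp_right_out i hj hk hk' hkn, smul_smul, ← sPow_add, scaledTwo, hj]
  congr 2; push_cast; ring

theorem braidOp_scaledTwo_out_out (hj : j ≠ i) (hj' : j ≠ i + 1) (hk : k ≠ i) (hk' : k ≠ i + 1)
    (hjn : j < n) (hkn : k < n) : braidOp n i (scaledTwo n j k) = scaledTwo n j k := by
  rw [scaledTwo, map_smul, braidOp_out_out i hj hj' hk hk' hjn hkn]

theorem scaledTwo_comm (n j k : ℕ) : scaledTwo n j k = scaledTwo n k j := by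
  rw [scaledTwo, scaledTwo, degTwo_comm, add_comm (j : ℤ)]

theorem braidOp_scaledTwo_out_left (hj : j ≠ i) (hj' : j ≠ i + 1) (hjn : j < n) (hk : k = i) :
    braidOp n i (scaledTwo n j k) =
      sPow (-2) • scaledTwo n j (i + 1) + (1 - sPow (-2)) • scaledTwo n j i := by
  simp only [scaledTwo_comm n j, braidOp_scaledTwo_left_out i hk hj hj' hjn]

theorem braidOp_scaledTwo_out_right (hj : j ≠ i) (hj' : j ≠ i + 1) (hjn : j < n)
    (hk : k = i + 1) : braidOp n i (scaledTwo n j k) = scaledTwo n j i := by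
  simp only [scaledTwo_comm n j, braidOp_scaledTwo_right_out i hk hj hj' hjn]

end

/-! ### Comparison of the two actions -/

theorem theta_ttPow_neg_one : theta (ttPow (-1)) = -qPow 2 := by
  have h : theta (ttPow (-1)) * theta (ttPow 1) = 1 := by
    rw [← map_mul, ← ttPow_add, neg_add_cancel, ttPow_zero, map_one]
  rw [theta_tt] at h
  linear_combination (-qPow 2) * h - theta (ttPow (-1)) * qPow_mul_neg 2

theorem theta_qqPow_neg_one : theta (qqPow (-1)) = sPow (-2) := theta_qqPow (-1)

/-- The basis `1 ⊗ F_{j,k}` of the fork module extended to `𝕃`. -/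
def forkBasis (n : ℕ) : Module.Basis (Pairs n) QSRing (QSRing ⊗[QTRing] LKBModule n) :=
  (Finsupp.basisSingleOne : Module.Basis (Pairs n) QTRing (LKBModule n)).baseChange QSRing

theorem forkBasis_apply {n : ℕ} (p : Pairs n) :
    forkBasis n p = (1 : QSRing) ⊗ₜ[QTRing] natFork n p.1.1 p.1.2 := by
  rw [forkBasis, Module.Basis.baseChange_apply, ← single_eq_natFork]
  rfl

/-- The `𝕃`-linear map from forks to highest weight vectors, `1 ⊗ F_{j,k} ↦ s^{j+k} w_{j,k}`. -/
def forkToTensor (n : ℕ) : QSRing ⊗[QTRing] LKBModule n →ₗ[QSRing] VermaTensor n :=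
  (forkBasis n).constr QSRing fun p => scaledW n p.1.1 p.1.2

theorem forkToTensor_natFork {n j k : ℕ} (hjk : j < k) (hk : k < n) :
    forkToTensor n (1 ⊗ₜ natFork n j k) = scaledW n j k := by
  have := (forkBasis n).constr_basis QSRing (fun p => scaledW n p.1.1 p.1.2)
    ⟨(⟨j, hjk.trans hk⟩, ⟨k, hk⟩), hjk⟩
  rwa [forkBasis_apply] at this

theorem one_tmul_smul {n : ℕ} (c : QTRing) (x : LKBModule n) :
    (1 : QSRing) ⊗ₜ[QTRing] (c • x) = theta c • ((1 : QSRing) ⊗ₜ[QTRing] x) := by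
  rw [TensorProduct.tmul_smul, ← algebraMap_smul QSRing c]
  rfl

/-- The action of `σ_i` on highest weight vectors is the action of `σ_i⁻¹` on forks. -/
theorem braidOp_forkToTensor {n : ℕ} (i : Fin (n - 1)) :
    braidOp n i ∘ₗ forkToTensor n = forkToTensor n ∘ₗ (lkbInvOp n i).baseChange QSRing := by
  refine (forkBasis n).ext fun p => ?_
  obtain ⟨⟨⟨x, hx⟩, ⟨y, hy⟩⟩, hxy⟩ := p
  replace hxy : x < y := hxy
  have hi := i.2
  have hq := qPow_mul_neg 2
  simp only [LinearMap.comp_apply, forkBasis_apply, LinearMap.baseChange_tmul,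
    forkToTensor_natFork hxy hy]
  -- coefficients are polynomials in `s⁻²`, `q²` and `q⁻²`, compared modulo `q² q⁻² = 1`
  have hx : x = i ∨ x = i + 1 ∨ (x ≠ i ∧ x ≠ i + 1) := by omega
  have hy : y = i ∨ y = i + 1 ∨ (y ≠ i ∧ y ≠ i + 1) := by omega
  rcases hx with hx | hx | hx <;> rcases hy with hy | hy | hy <;>
    first
    | (exfalso; omega)
    | (try subst hx
       try subst hy
       simp (disch := omega) only [lkbInvOp_left_right, lkbInvOp_left_out, lkbInvOp_out_left,
         lkbInvOp_right_out, lkbInvOp_out_right, lkbInvOp_out_out, TensorProduct.tmul_add,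
         TensorProduct.tmul_sub, one_tmul_smul, map_add, map_sub, map_smul, forkToTensor_natFork,
         map_neg, map_mul, map_pow, map_one, theta_ttPow_neg_one, theta_qqPow_neg_one]
       simp (disch := omega) only [scaledW, map_sub, map_smul, braidOp_scaledTwo_left_left,
         braidOp_scaledTwo_left_right, braidOp_scaledTwo_left_out, braidOp_scaledTwo_out_left,
         braidOp_scaledTwo_right_out, braidOp_scaledTwo_out_right, braidOp_scaledTwo_out_out,
         braidOp_scaledTwo_right_right]
       try (match_scalars <;> grind))

/-! ### The weight decomposition of `V^{⊗n}` -/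

instance : IsDomain QSRing :=
  inferInstanceAs (IsDomain (LaurentPolynomial (LaurentPolynomial ℤ)))

theorem qPow_eq_C_T (k : ℤ) :
    qPow k = (LaurentPolynomial.C (LaurentPolynomial.T k) :
      LaurentPolynomial (LaurentPolynomial ℤ)) := by
  have h (m : ℕ) : qPow m = (LaurentPolynomial.C (LaurentPolynomial.T m) :
      LaurentPolynomial (LaurentPolynomial ℤ)) := by
    rw [qPow, zpow_natCast, Units.val_pow_eq_pow_val]
    refine (map_pow LaurentPolynomial.C (LaurentPolynomial.T (R := ℤ) 1) m).symm.trans ?_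
    rw [LaurentPolynomial.T_pow, mul_one]
  obtain ⟨m, rfl | rfl⟩ := k.eq_nat_or_neg
  · exact h m
  · refine mul_left_cancel₀ (a := qPow m) (fun h0 => ?_) ?_
    · have := qPow_mul_neg m
      rw [h0, zero_mul] at this
      exact zero_ne_one this
    · rw [qPow_mul_neg, h]
      refine Eq.trans ?_ (map_mul LaurentPolynomial.C _ _)
      rw [← LaurentPolynomial.T_add, add_neg_cancel, LaurentPolynomial.T_zero, map_one]
      rfl

theorem qPow_injective : Function.Injective qPow := by
  intro a b h
  rw [qPow_eq_C_T, qPow_eq_C_T] at h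
  have h' := congrArg (LaurentPolynomial.eval₂ (RingHom.id (LaurentPolynomial ℤ)) 1) h
  rw [LaurentPolynomial.eval₂_C, LaurentPolynomial.eval₂_C] at h'
  by_contra hab
  have := congrArg (fun f => f.coeff a) h'
  simp [LaurentPolynomial.T_apply] at this
  exact hab this.symm

theorem qPow_sum {ι : Type*} (S : Finset ι) (f : ι → ℤ) :
    qPow (∑ i ∈ S, f i) = ∏ i ∈ S, qPow (f i) := by
  classical
  induction S using Finset.induction_on with
  | empty => simp [qPow_zero]
  | insert a S ha ih => rw [Finset.sum_insert ha, Finset.prod_insert ha, qPow_add, ih]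

theorem sPow_ne_zero (a : ℤ) : sPow a ≠ 0 := fun h => by
  have := sPow_mul_neg a
  rw [h, zero_mul] at this
  exact zero_ne_one this

theorem sPow_natCast (m : ℕ) : sPow m = sPow 1 ^ m := by simp [sPow]

theorem prod_opK_scalar {ι : Type*} (S : Finset ι) (α : ι → ℕ) :
    ∏ i ∈ S, (sPow 1 * qPow (-2 * (α i : ℤ))) =
      sPow (S.card : ℕ) * qPow (-2 * ((∑ i ∈ S, α i : ℕ) : ℤ)) := by
  rw [Finset.prod_mul_distrib, Finset.prod_const, ← qPow_sum, ← Finset.mul_sum, sPow_natCast]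
  push_cast
  rfl

theorem basisTensor_apply {n : ℕ} (α : Fin n → ℕ) :
    basisTensor n α = PiTensorProduct.tprod QSRing fun i => v (α i) :=
  Basis.piTensorProduct_apply _ _

theorem tensorK_basis {n : ℕ} (α : Fin n → ℕ) : tensorK n (basisTensor n α) =
    (sPow n * qPow (-2 * ((∑ i, α i : ℕ) : ℤ))) • basisTensor n α := by
  rw [basisTensor_apply, tensorK, PiTensorProduct.map_tprod]
  simp only [opK_v]
  rw [MultilinearMap.map_smul_univ, prod_opK_scalar, Finset.card_univ, Fintype.card_fin]

theorem repr_tensorK {n : ℕ} (x : VermaTensor n) (α : Fin n → ℕ) :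
    (basisTensor n).repr (tensorK n x) α =
      (sPow n * qPow (-2 * ((∑ i, α i : ℕ) : ℤ))) * (basisTensor n).repr x α := by
  suffices h : Finsupp.lapply α ∘ₗ (basisTensor n).repr.toLinearMap ∘ₗ tensorK n =
      (sPow n * qPow (-2 * ((∑ i, α i : ℕ) : ℤ))) •
        (Finsupp.lapply α ∘ₗ (basisTensor n).repr.toLinearMap) from LinearMap.congr_fun h x
  refine (basisTensor n).ext fun β => ?_
  simp only [LinearMap.comp_apply, tensorK_basis, map_smul, LinearMap.smul_apply,
    LinearEquiv.coe_coe, Module.Basis.repr_self, Finsupp.lapply_apply, Finsupp.single_apply]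
  by_cases h : β = α
  · rw [h]
  · simp [h]

/-- Vectors of weight `s^n q^{-2l}` have degree `l`. -/
theorem degree_of_mem_weightSpace {n l : ℕ} {x : VermaTensor n} (hx : x ∈ weightSpace n l)
    {α : Fin n → ℕ} (hα : (basisTensor n).repr x α ≠ 0) : ∑ i, α i = l := by
  rw [weightSpace, LinearMap.mem_ker, LinearMap.sub_apply, sub_eq_zero] at hx
  have h := repr_tensorK x α
  rw [hx, LinearMap.smul_apply, LinearMap.id_apply, map_smul, Finsupp.smul_apply, smul_eq_mul] at h
  have h := qPow_injective (mul_left_cancel₀ (sPow_ne_zero _) (mul_right_cancel₀ hα h))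
  omega

theorem basisTensor_mem_weightSpace {n : ℕ} (α : Fin n → ℕ) :
    basisTensor n α ∈ weightSpace n (∑ i, α i) := by
  rw [weightSpace, LinearMap.mem_ker, LinearMap.sub_apply, tensorK_basis, LinearMap.smul_apply,
    LinearMap.id_apply, sub_self]

/-! ### The action of `E` in degree two -/

theorem tensorE_basis {n : ℕ} (α : Fin n → ℕ) : tensorE n (basisTensor n α) =
    ∑ i, if α i = 0 then 0 else
      (sPow ((n : ℤ) - 1 - i) * qPow (-2 * ((∑ l ∈ Finset.Ioi i, α l : ℕ) : ℤ))) •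
        basisTensor n (Function.update α i (α i - 1)) := by
  rw [tensorE, LinearMap.sum_apply]
  refine Finset.sum_congr rfl fun i _ => ?_
  rw [basisTensor_apply, PiTensorProduct.map_tprod]
  split_ifs with h
  · refine MultilinearMap.map_coord_zero _ i ?_
    simp [h, opE_zero]
  · obtain ⟨a, ha⟩ := Nat.exists_eq_succ_of_ne_zero h
    have h1 : (fun j => (if j < i then LinearMap.id else if j = i then opE else opK) (v (α j))) =
        fun j => (if i < j then sPow 1 * qPow (-2 * (α j : ℤ)) else 1) •
          v (Function.update α i (α i - 1) j) := by
      funext j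
      rcases lt_trichotomy j i with hj | rfl | hj
      · simp [hj, hj.ne, hj.not_gt]
      · simp [ha, opE_succ]
      · simp [hj, hj.ne', hj.not_gt, opK_v]
    rw [h1, MultilinearMap.map_smul_univ, ← basisTensor_apply, Finset.prod_ite, Finset.prod_const_one,
      mul_one, Finset.filter_lt_eq_Ioi, prod_opK_scalar, Fin.card_Ioi]
    congr 3
    have := i.2
    omega

theorem tensorE_aVec {n : ℕ} {j k : Fin n} (hjk : j < k) :
    tensorE n (basisTensor n (Pi.single j 1 + Pi.single k 1)) =
      (sPow ((n : ℤ) - 1 - j) * qPow (-2)) • basisTensor n (Pi.single k 1) +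
        sPow ((n : ℤ) - 1 - k) • basisTensor n (Pi.single j 1) := by
  have sum1 (i l : Fin n) : ∑ x ∈ Finset.Ioi i, (Pi.single l 1 : Fin n → ℕ) x =
      if i < l then 1 else 0 := by
    simp [Pi.single_apply]
  rw [tensorE_basis, Fintype.sum_eq_add j k hjk.ne]
  · simp only [Pi.add_apply, Finset.sum_add_distrib, sum1]
    have e1 : Function.update (Pi.single j 1 + Pi.single k 1 : Fin n → ℕ) j 0 = Pi.single k 1 := by
      funext m
      by_cases h : m = j
      · subst h; simp [hjk.ne]
      · simp [h]
    have e2 : Function.update (Pi.single j 1 + Pi.single k 1 : Fin n → ℕ) k 0 = Pi.single j 1 := by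
      funext m
      by_cases h : m = k
      · subst h; simp [hjk.ne']
      · simp [h]
    simp [hjk, hjk.ne, hjk.ne', hjk.not_gt, e1, e2, qPow_zero]
  · rintro i ⟨h1, h2⟩
    simp [h1, h2]

theorem tensorE_bVec {n : ℕ} (k : Fin n) :
    tensorE n (basisTensor n (Pi.single k 1 + Pi.single k 1)) =
      sPow ((n : ℤ) - 1 - k) • basisTensor n (Pi.single k 1) := by
  rw [tensorE_basis, Fintype.sum_eq_single k]
  · have e : Function.update (Pi.single k 1 + Pi.single k 1 : Fin n → ℕ) k 1 = Pi.single k 1 := by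
      funext m
      by_cases h : m = k
      · subst h; simp
      · simp [h]
    simp [Finset.sum_add_distrib, Pi.single_apply, e, qPow_zero]
  · intro i h
    simp [h]

/-! ### The basis of the highest weight space -/

theorem wVec_eq {n : ℕ} (p : Pairs n) : wVec p =
    basisTensor n (Pi.single p.1.1 1 + Pi.single p.1.2 1)
      - (sPow ((p.1.2.val : ℤ) - p.1.1.val) * qPow (-2)) •
        basisTensor n (Pi.single p.1.2 1 + Pi.single p.1.2 1)
      - sPow ((p.1.1.val : ℤ) - p.1.2.val) •
        basisTensor n (Pi.single p.1.1 1 + Pi.single p.1.1 1) := by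
  rw [wVec, aVec_eq p.2.ne, bVec_eq, bVec_eq, degTwo_val, degTwo_val, degTwo_val]

theorem wVec_mem {n : ℕ} (p : Pairs n) : wVec p ∈ highestWeightSpace n 2 := by
  have hK (j k : Fin n) : basisTensor n (Pi.single j 1 + Pi.single k 1) ∈ weightSpace n 2 := by
    convert basisTensor_mem_weightSpace (Pi.single j 1 + Pi.single k 1 : Fin n → ℕ) using 2
    simp [Finset.sum_add_distrib]
  rw [wVec_eq]
  refine ⟨?_, sub_mem (sub_mem (hK _ _) (Submodule.smul_mem _ _ (hK _ _)))
    (Submodule.smul_mem _ _ (hK _ _))⟩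
  change tensorE n _ = 0
  rw [map_sub, map_sub, map_smul, map_smul, tensorE_aVec p.2, tensorE_bVec,
    tensorE_bVec, smul_smul, smul_smul, mul_right_comm, ← sPow_add, ← sPow_add]
  rw [show (p.1.2.val : ℤ) - p.1.1.val + (n - 1 - p.1.2.val) = n - 1 - p.1.1.val by ring,
    show (p.1.1.val : ℤ) - p.1.2.val + (n - 1 - p.1.1.val) = n - 1 - p.1.2.val by ring]
  abel

theorem exists_eq_single_add {n m : ℕ} {α : Fin n → ℕ} (h : ∑ i, α i = m + 1) :
    ∃ (j : Fin n) (β : Fin n → ℕ), α = Pi.single j 1 + β ∧ ∑ i, β i = m := by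
  obtain ⟨j, -, hj⟩ := Finset.exists_ne_zero_of_sum_ne_zero (h.trans_ne m.succ_ne_zero)
  have hle : Pi.single j 1 ≤ α := by
    intro i
    by_cases hi : i = j
    · subst hi
      simpa [Nat.one_le_iff_ne_zero] using hj
    · simp [hi]
  obtain ⟨β, rfl⟩ := exists_add_of_le hle
  refine ⟨j, β, rfl, ?_⟩
  simp [Finset.sum_add_distrib] at h
  omega

theorem eq_single_add_single {n : ℕ} {α : Fin n → ℕ} (h : ∑ i, α i = 2) :
    ∃ j k, α = Pi.single j 1 + Pi.single k 1 := by
  obtain ⟨j, β, rfl, hβ⟩ := exists_eq_single_add h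
  obtain ⟨k, γ, rfl, hγ⟩ := exists_eq_single_add hβ
  have : γ = 0 := by
    funext i
    simpa using (Finset.sum_eq_zero_iff.1 hγ) i (Finset.mem_univ i)
  exact ⟨j, k, by rw [this, add_zero]⟩

theorem single_add_single_inj {n : ℕ} {j k j' k' : Fin n} (h : j ≤ k) (h' : j' ≤ k')
    (e : (Pi.single j 1 + Pi.single k 1 : Fin n → ℕ) = Pi.single j' 1 + Pi.single k' 1) :
    j = j' ∧ k = k' := by
  have e1 := congrFun e j
  have e2 := congrFun e k
  have e3 := congrFun e j'
  have e4 := congrFun e k'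
  simp only [Pi.add_apply, Pi.single_apply] at e1 e2 e3 e4
  grind

/-- A highest weight vector of degree two whose coefficients at all `a_{j,k}` vanish is zero: it is
a combination of the `b_k`, whose images under `E` are linearly independent. -/
theorem eq_zero_of_repr_eq_zero {n : ℕ} {x : VermaTensor n} (hx : x ∈ highestWeightSpace n 2)
    (h : ∀ p : Pairs n, (basisTensor n).repr x (Pi.single p.1.1 1 + Pi.single p.1.2 1) = 0) :
    x = 0 := by
  set b := basisTensor n with hb
  set d : Fin n → QSRing := fun k => b.repr x (Pi.single k 1 + Pi.single k 1) with hd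
  have hsum : x = ∑ k, d k • b (Pi.single k 1 + Pi.single k 1) := by
    refine b.repr.injective (Finsupp.ext fun α => ?_)
    simp only [map_sum, map_smul, Module.Basis.repr_self, Finsupp.finsetSum_apply,
      Finsupp.smul_apply, Finsupp.single_apply, smul_eq_mul, mul_ite, mul_one, mul_zero]
    by_cases hα : ∃ k, α = Pi.single k 1 + Pi.single k 1
    · obtain ⟨k, rfl⟩ := hα
      rw [Fintype.sum_eq_single k, if_pos rfl]
      intro l hl
      exact if_neg fun e => hl (single_add_single_inj le_rfl le_rfl e).1
    · rw [Finset.sum_eq_zero fun k _ => if_neg fun e => hα ⟨k, e.symm⟩]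
      -- the weight condition leaves only exponents of degree two, that is the `a_{j,k}`
      by_contra h0
      obtain ⟨j, k, rfl⟩ := eq_single_add_single (degree_of_mem_weightSpace hx.2 h0)
      rcases lt_trichotomy j k with hjk | rfl | hjk
      · exact h0 (h ⟨(j, k), hjk⟩)
      · exact hα ⟨j, rfl⟩
      · rw [add_comm] at h0
        exact h0 (h ⟨(k, j), hjk⟩)
  have hE : tensorE n x = 0 := hx.1
  rw [hsum, map_sum] at hE
  simp only [map_smul, hb, tensorE_bVec, smul_smul] at hE
  have hd0 (k : Fin n) : d k = 0 := by
    have h1 := DFunLike.congr_fun (congrArg b.repr hE) (Pi.single k 1)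
    simp only [← hb, map_sum, map_smul, Module.Basis.repr_self, Finsupp.finsetSum_apply,
      Finsupp.smul_apply, Finsupp.single_apply, smul_eq_mul, mul_ite, mul_one, mul_zero,
      map_zero, Finsupp.zero_apply] at h1
    rw [Fintype.sum_eq_single k, if_pos rfl] at h1
    · exact (mul_eq_zero.1 h1).resolve_right (sPow_ne_zero _)
    · intro l hl
      refine if_neg fun e => hl ?_
      have := congrFun e l
      by_contra hlk
      simp [hlk] at this
  rw [hsum]
  simp [hd0]

theorem repr_wVec {n : ℕ} (p p' : Pairs n) :
    (basisTensor n).repr (wVec p) (Pi.single p'.1.1 1 + Pi.single p'.1.2 1) =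
      if p = p' then 1 else 0 := by
  have hne (k : Fin n) :
      (Pi.single k 1 + Pi.single k 1 : Fin n → ℕ) ≠ Pi.single p'.1.1 1 + Pi.single p'.1.2 1 :=
    fun e => p'.2.ne <| (single_add_single_inj le_rfl p'.2.le e).1.symm.trans
      (single_add_single_inj le_rfl p'.2.le e).2
  have hiff : (Pi.single p.1.1 1 + Pi.single p.1.2 1 : Fin n → ℕ) =
      Pi.single p'.1.1 1 + Pi.single p'.1.2 1 ↔ p = p' :=
    ⟨fun e => Subtype.ext (Prod.ext (single_add_single_inj p.2.le p'.2.le e).1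
      (single_add_single_inj p.2.le p'.2.le e).2), fun e => by rw [e]⟩
  simp only [wVec_eq, map_sub, map_smul, Module.Basis.repr_self, Finsupp.sub_apply,
    Finsupp.smul_apply, Finsupp.single_apply, if_neg (hne _), hiff, smul_zero, sub_zero]

/-- The basis of `W_{n,2}` formed by the vectors `w_{i,j}`. -/
def wBasis (n : ℕ) : Module.Basis (Pairs n) QSRing (highestWeightSpace n 2) :=
  Module.Basis.mk (v := fun p => (⟨wVec p, wVec_mem p⟩ : highestWeightSpace n 2))
    (by
      rw [Fintype.linearIndependent_iff]
      intro g hg p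
      have h1 := congrArg (fun x : highestWeightSpace n 2 =>
        (basisTensor n).repr (x : VermaTensor n) (Pi.single p.1.1 1 + Pi.single p.1.2 1)) hg
      simpa [Finsupp.finsetSum_apply, repr_wVec] using h1)
    (by
      rintro x -
      have h : x = ∑ p : Pairs n, (basisTensor n).repr (x : VermaTensor n)
          (Pi.single p.1.1 1 + Pi.single p.1.2 1) •
            (⟨wVec p, wVec_mem p⟩ : highestWeightSpace n 2) := by
        rw [← sub_eq_zero]
        refine Subtype.ext (eq_zero_of_repr_eq_zero (Subtype.property _) fun p => ?_)
        simp [repr_wVec]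
      rw [h]
      exact sum_mem fun p _ => Submodule.smul_mem _ _ (Submodule.subset_span ⟨p, rfl⟩))

theorem wBasis_apply {n : ℕ} (p : Pairs n) : (wBasis n p : VermaTensor n) = wVec p := by
  rw [wBasis, Module.Basis.mk_apply]

/-! ### The isomorphism of representations -/

/-- The scalar `s^{i+j}` attached to a pair of positions, as a unit. -/
def pairUnit {n : ℕ} (p : Pairs n) : QSRingˣ := s ^ ((p.1.1.val + 1 : ℤ) + (p.1.2.val + 1))

/-- The isomorphism `W_{n,2} ≅ LKB(2, n) ⊗_θ 𝕃` with `s^{i+j} w_{i,j} ↦ 1 ⊗ F_{i,j}`. -/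
def wEquiv (n : ℕ) : highestWeightSpace n 2 ≃ₗ[QSRing] QSRing ⊗[QTRing] LKBModule n :=
  ((wBasis n).unitsSMul pairUnit).equiv (forkBasis n) (Equiv.refl _)

theorem wEquiv_scaled {n : ℕ} (p : Pairs n) :
    wEquiv n (sPow ((p.1.1.val + 1 : ℤ) + (p.1.2.val + 1)) • wBasis n p) = forkBasis n p := by
  have := ((wBasis n).unitsSMul pairUnit).equiv_apply p (forkBasis n) (Equiv.refl _)
  rwa [Module.Basis.unitsSMul_apply] at this

theorem wEquiv_symm_apply {n : ℕ} (x : QSRing ⊗[QTRing] LKBModule n) :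
    ((wEquiv n).symm x : VermaTensor n) = forkToTensor n x := by
  suffices h : (highestWeightSpace n 2).subtype ∘ₗ (wEquiv n).symm.toLinearMap = forkToTensor n from
    LinearMap.congr_fun h x
  refine (forkBasis n).ext fun p => ?_
  rw [LinearMap.comp_apply, LinearEquiv.coe_coe, ← wEquiv_scaled, LinearEquiv.symm_apply_apply,
    wEquiv_scaled, forkToTensor, Module.Basis.constr_basis, scaledW_eq, map_smul,
    Submodule.subtype_apply, wBasis_apply]

/-- The representation of `B_n` on `W_{n,2}`, transported from the forks. -/
def wRep (n : ℕ) : Representation QSRing (BraidGroup n) (highestWeightSpace n 2) :=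
  (LinearEquiv.conjAlgEquiv QSRing (wEquiv n).symm : _ →* _).comp (daggerExtend (lkbRep n))

theorem wRep_apply {n : ℕ} (β : BraidGroup n) (w : highestWeightSpace n 2) :
    wRep n β w = (wEquiv n).symm (daggerExtend (lkbRep n) β (wEquiv n w)) := rfl

/-- The transported representation is the restriction of the R-matrix action. -/
theorem wRep_sigma {n : ℕ} (i : Fin (n - 1)) (w : highestWeightSpace n 2) :
    (wRep n (sigma i) w : VermaTensor n) = braidOp n i (w : VermaTensor n) := by
  have h1 : daggerExtend (lkbRep n) (sigma i) = (lkbInvOp n i).baseChange QSRing := by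
    rw [← lkbRep_sigma_inv, ← mirror_sigma]
    rfl
  have h2 := LinearMap.congr_fun (braidOp_forkToTensor i) (wEquiv n w)
  rw [LinearMap.comp_apply, LinearMap.comp_apply, ← wEquiv_symm_apply,
    LinearEquiv.symm_apply_apply] at h2
  rw [wRep_apply, wEquiv_symm_apply, h1, h2]

end BraidLKB

end

theorem theorem2 (n : ℕ) (hn : 1 < n) :
    -- the braid group acts on `W_{n,2}` by restriction of the R-matrix operators
    ∃ (ρW : Representation QSRing (BraidGroup n) (highestWeightSpace n 2)),
      (∀ (i : Fin (n - 1)) (w : highestWeightSpace n 2),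
        (ρW (sigma i) w : VermaTensor n) = braidOp n i (w : VermaTensor n)) ∧
    -- the Lawrence-Krammer-Bigelow representation
    ∃ (ρK : Representation QTRing (BraidGroup n) (LKBModule n)),
      (∀ i : Fin (n - 1), ρK (sigma i)⁻¹ = lkbInvOp n i) ∧
    -- the basis of the `w_{i,j}` and the isomorphism
    ∃ (𝒲 : Module.Basis (Pairs n) QSRing (highestWeightSpace n 2))
      (Φ : Representation.Equiv ρW (daggerExtend ρK)),
      (∀ p : Pairs n, (𝒲 p : VermaTensor n) = wVec p) ∧
      (∀ p : Pairs n,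
        Φ (sPow ((p.1.1.val + 1 : ℤ) + (p.1.2.val + 1)) • 𝒲 p)
          = (1 : QSRing) ⊗ₜ[QTRing] fork p.1.1 p.1.2) := by
  refine ⟨wRep n, wRep_sigma, lkbRep n, lkbRep_sigma_inv, wBasis n,
    Representation.Equiv.mk (wEquiv n) fun β => LinearMap.ext fun w => ?_, wBasis_apply,
    fun p => ?_⟩
  · rw [LinearMap.comp_apply, LinearMap.comp_apply, LinearEquiv.coe_coe, wRep_apply,
      LinearEquiv.apply_symm_apply]
  · rw [← natFork_val, ← forkBasis_apply]
    exact wEquiv_scaled p
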